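/- **Setting.** Let $D$ be an item domain with at least two items and $\tilde D$ an encoded domain. A pure $\epsilon$-LDP frequency protocol consists of a randomized map $\Psi$ from $D$ to $\tilde D$ that satisfies $\Pr[\Psi(v_1)\in T]\le e^{\epsilon}\Pr[\Psi(v_2)\in T]$ for all $v_1,v_2\in D$ and all (measurable) $T\subseteq\tilde D$, of a support map $S$ that assigns to each report $y\in\tilde D$ the set $S(y)\subseteq D$ of items it supports, and of numbers $p\ne q$ such that $\Pr[v\in S(\Psi(v))]=p$ for all $v\in D$ and $\Pr[v\in S(\Psi(x))]=q$ for all $x\neq v$. From $N$ reports $z_1,\dots,z_N$ the server computes the aggregated frequency $$\tilde f(v)=\frac1N\cdot\frac{C(v)-Nq}{p-q},\qquad C(v)=\#\{i: v\in S(z_i)\},$$ and $\Phi_y(v)=\frac{\mathbb 1[v\in S(y)]-q}{p-q}$ denotes the estimated count of $v$ in a single report $y$. There are $n$ genuine users holding items $X=(x_1,\dots,x_n)\in D^n$, who report $\tilde x_i=\Psi(x_i)$, and $m$ malicious users, whose reports $y_1,\dots,y_m$ are drawn from a fixed attacker-designed probability distribution $P$ on $\tilde D$; all $n+m$ reports are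 independent. The data $X$ may vary arbitrarily with $n$. Let $\tilde f_Z(v)$ be the poisoned frequency, i.e. the frequency of $v$ aggregated from all $n+m$ reports, let $f_X(v)=\frac1n\#\{i:x_i=v\}$ be the true frequency of $v$ in $X$, and put $\eta=m/n$, $$\mu_{\tilde x}=f_X(v),\qquad \sigma_{\tilde x}^2=\frac{q(1-q)}{n(p-q)^2}+\frac{f_X(v)(1-p-q)}{n(p-q)},\qquad \mu_y=\mathbf E_{y\sim P}[\Phi_y(v)],\qquad \sigma_y^2=\frac{\mathbf{Var}_{y\sim P}[\Phi_y(v)]}{m}.$$ **Theorem 1.** For every $v\in D$, the asymptotic distribution of $\tilde f_Z(v)$ as $n,m\to\infty$ is $\mathcal N(\mu_z,\sigma_z^2)$, where $$\mu_z=\frac{1}{1+\eta}\mu_{\tilde x}+\frac{\eta}{1+\eta}\mu_y,\qquad \sigma_z^2=\frac{1}{(1+\eta)^2}\sigma_{\tilde x}^2+\frac{\eta^2}{(1+\eta)^2}\sigma_y^2 .$$ That is, $\sigma_z^2>0$ for all $n,m\ge1$, and $(\tilde f_Z(v)-\mu_z)/\sigma_z$ converges in distribution to $\mathcal N(0,1)$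 as $n$ and $m$ tend to infinity jointly (with no condition on the ratio $m/n$). -/

import Mathlib

open MeasureTheory ProbabilityTheory Filter Topology
open scoped NNReal ENNReal

noncomputable section

/-- A pure `ε`-LDP frequency protocol with input domain `D` and encoded domain `E`.
`perturb x` is the law of the perturbed report of a user holding `x`, and `support y` is the set
of items that the report `y` supports.  An item is supported by the report of a user who holds it
with probability `p`, and by the report of a user who holds another item with probability `q`. -/
structure PureLDPProtocol (ε : ℝ) (D E : Type*) [MeasurableSpace E] where
  /-- law of the perturbed report -/
  perturb : D → Measure E
  isProbabilityMeasure_perturb : ∀ x, IsProbabilityMeasure (perturb x)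
  /-- the items supported by a report -/
  support : E → Set D
  measurableSet_support : ∀ v, MeasurableSet {y | v ∈ support y}
  /-- the privacy requirement -/
  ldp : ∀ v₁ v₂ : D, ∀ T : Set E, MeasurableSet T →
    perturb v₁ T ≤ ENNReal.ofReal (Real.exp ε) * perturb v₂ T
  p : ℝ
  q : ℝ
  p_ne_q : p ≠ q
  prob_support_self : ∀ v, (perturb v).real {y | v ∈ support y} = p
  prob_support_of_ne : ∀ x v, x ≠ v → (perturb x).real {y | v ∈ support y} = q

namespace PureLDPProtocol

variable {ε : ℝ} {D E : Type*} [MeasurableSpace E]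

/-- The characteristic function `1_{S(y)}(v)`. -/
def supportIndicator (A : PureLDPProtocol ε D E) (v : D) (y : E) : ℝ :=
  Set.indicator {y | v ∈ A.support y} (fun _ => 1) y

/-- The estimated count of `v` in a single report `y`. -/
def estimate (A : PureLDPProtocol ε D E) (v : D) (y : E) : ℝ :=
  (A.supportIndicator v y - A.q) / (A.p - A.q)

/-- The number of reports in the finite family `z` that support `v`. -/
def supportCount (A : PureLDPProtocol ε D E) {ι : Type*} [Fintype ι] (v : D) (z : ι → E) : ℝ :=
  ∑ i, A.supportIndicator v (z i)

/-- The estimated count of `v` in the finite family of reports `z`. -/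
def estimatedCount (A : PureLDPProtocol ε D E) {ι : Type*} [Fintype ι] (v : D) (z : ι → E) : ℝ :=
  (A.supportCount v z - Fintype.card ι * A.q) / (A.p - A.q)

/-- The frequency of `v` aggregated from the finite family of reports `z`. -/
def aggFreq (A : PureLDPProtocol ε D E) {ι : Type*} [Fintype ι] (v : D) (z : ι → E) : ℝ :=
  A.estimatedCount v z / Fintype.card ι

/-- The random reports of one poisoned collection: `n` genuine users holding the items `x`
perturb them with the protocol, `m` malicious users send samples from the attacker-designed law `P`
on the encoded domain, and all `n + m` reports are independent. -/
structure IsPoisonedCollection (A : PureLDPProtocol ε D E) (P : Measure E) {n m : ℕ}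
    (x : Fin n → D) {Ω : Type*} [MeasurableSpace Ω] (μ : Measure Ω)
    (X : Fin n → Ω → E) (Y : Fin m → Ω → E) : Prop where
  hasLaw_genuine : ∀ i, HasLaw (X i) (A.perturb (x i)) μ
  hasLaw_malicious : ∀ j, HasLaw (Y j) P μ
  indep : iIndepFun (Sum.elim X Y) μ

/-- The poisoned frequency of `v`: it is aggregated from all genuine and malicious reports. -/
def poisonedFreq (A : PureLDPProtocol ε D E) {n m : ℕ} {Ω : Type*} (v : D)
    (X : Fin n → Ω → E) (Y : Fin m → Ω → E) (ω : Ω) : ℝ :=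
  A.aggFreq v (Sum.elim (fun i => X i ω) (fun j => Y j ω))

end PureLDPProtocol

/-- The true frequency of `v` in the data `x`. -/
def trueFreq {D : Type*} {n : ℕ} (x : Fin n → D) (v : D) : ℝ :=
  ({i | x i = v} : Set (Fin n)).ncard / (n : ℝ)

namespace PureLDPProtocol

variable {ε : ℝ} {D E : Type*} [MeasurableSpace E]

/-- `μ_x = f_X(v)`. -/
def muGenuine {n : ℕ} (x : Fin n → D) (v : D) : ℝ := trueFreq x v

/-- `σ_x²`. -/
def varGenuine (A : PureLDPProtocol ε D E) {n : ℕ} (x : Fin n → D) (v : D) : ℝ :=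
  A.q * (1 - A.q) / (n * (A.p - A.q) ^ 2)
    + trueFreq x v * (1 - A.p - A.q) / (n * (A.p - A.q))

/-- `μ_y`, the mean of the estimated count of `v` in one malicious report. -/
def muMalicious (A : PureLDPProtocol ε D E) (P : Measure E) (v : D) : ℝ :=
  ∫ y, A.estimate v y ∂P

/-- `σ_y²`, the variance of the estimated count of `v` in one malicious report, over `m`. -/
def varMalicious (A : PureLDPProtocol ε D E) (P : Measure E) (m : ℕ) (v : D) : ℝ :=
  variance (A.estimate v) P / m

/-- `μ_z`, where `η = m / n`. -/
def muPoisoned (A : PureLDPProtocol ε D E) (P : Measure E) {n : ℕ} (m : ℕ)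
    (x : Fin n → D) (v : D) : ℝ :=
  let η : ℝ := m / n
  1 / (1 + η) * muGenuine x v + η / (1 + η) * A.muMalicious P v

/-- `σ_z²`, where `η = m / n`. -/
def varPoisoned (A : PureLDPProtocol ε D E) (P : Measure E) {n : ℕ} (m : ℕ)
    (x : Fin n → D) (v : D) : ℝ :=
  let η : ℝ := m / n
  1 / (1 + η) ^ 2 * A.varGenuine x v + η ^ 2 / (1 + η) ^ 2 * A.varMalicious P m v

end PureLDPProtocol

end

/-!
The poisoned frequency is the average over all `n + m` reports of the single-report estimates
`Φ_y(v)`.  These are independent and take two values only, so they are bounded uniformly in `n`,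
`m` and the data.  Matching the moments of a genuine report against the formulas of the definitions
(`muPoisoned_eq`, `varPoisoned_eq`) shows that `μ_z` and `σ_z²` are exactly the mean and the
variance of this average.  Hence the normalized poisoned frequency is a standardized sum of
independent, uniformly bounded variables (`IsPoisonedCollection.poisonedFreq_sub_div_sqrt`).

Such a sum is asymptotically normal as soon as its variance tends to infinity
(`tendstoInDistribution_standardized_sum_of_bounded`).  The proof compares characteristic functions:
a centred summand `W` with `|W| ≤ M` satisfies `φ_W(u) = exp (-Var W * u² / 2) + O(M |u|³ Var W)`, and
a product of numbers in the unit disc depends on its factors in a 1-Lipschitz way, so the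
standardized sum differs from the Gaussian by `O(M |t|³ / s)`, with `s²` the total variance.

The variance does tend to infinity because of privacy: if a report supported `v` with probability
`0` or `1` for one item held, the same would be true for all items, which contradicts `p ≠ q`.
So `p` and `q` lie in `(0, 1)`, and each genuine estimate contributes at least a fixed positive
amount of variance.  The malicious part can only add to it, even if the attack is deterministic,
so no condition on `m / n` is needed.
-/

/-! ### Characteristic functions of bounded variables -/

lemma norm_prod_sub_prod_le {ι : Type*} (s : Finset ι) {a b : ι → ℂ}
    (ha : ∀ i ∈ s, ‖a i‖ ≤ 1) (hb : ∀ i ∈ s, ‖b i‖ ≤ 1) :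
    ‖∏ i ∈ s, a i - ∏ i ∈ s, b i‖ ≤ ∑ i ∈ s, ‖a i - b i‖ := by
  classical
  induction s using Finset.induction_on with
  | empty => simp
  | insert j s hj ih =>
    rw [Finset.prod_insert hj, Finset.prod_insert hj, Finset.sum_insert hj]
    have ih' := ih (fun i hi => ha i (Finset.mem_insert_of_mem hi))
      (fun i hi => hb i (Finset.mem_insert_of_mem hi))
    have hprod : ‖∏ i ∈ s, b i‖ ≤ 1 := by
      rw [norm_prod]
      exact Finset.prod_le_one (fun _ _ => norm_nonneg _)
        fun i hi => hb i (Finset.mem_insert_of_mem hi)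
    calc ‖a j * ∏ i ∈ s, a i - b j * ∏ i ∈ s, b i‖
        = ‖a j * (∏ i ∈ s, a i - ∏ i ∈ s, b i) + (a j - b j) * ∏ i ∈ s, b i‖ := by
          congr 1; ring
      _ ≤ ‖a j‖ * ‖∏ i ∈ s, a i - ∏ i ∈ s, b i‖ + ‖a j - b j‖ * ‖∏ i ∈ s, b i‖ := by
          rw [← norm_mul, ← norm_mul]; exact norm_add_le _ _
      _ ≤ 1 * ∑ i ∈ s, ‖a i - b i‖ + ‖a j - b j‖ * 1 := by
          gcongr
          exact ha j (Finset.mem_insert_self _ _)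
      _ = ‖a j - b j‖ + ∑ i ∈ s, ‖a i - b i‖ := by ring

lemma norm_cexp_mul_I_sub_taylor_two_le {y : ℝ} (hy : |y| ≤ 1) :
    ‖Complex.exp (y * Complex.I) - (1 + y * Complex.I - y ^ 2 / 2)‖ ≤ |y| ^ 3 := by
  have h := Complex.exp_bound (x := y * Complex.I) (by simpa using hy) (n := 3) (by norm_num)
  have hsum : ∑ k ∈ Finset.range 3, ((y : ℂ) * Complex.I) ^ k / (k.factorial : ℂ)
      = 1 + y * Complex.I - y ^ 2 / 2 := by
    simp only [Finset.sum_range_succ, Finset.sum_range_zero, mul_pow, Complex.I_sq]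
    simp [Nat.factorial]
    ring
  rw [hsum] at h
  refine h.trans ?_
  simp only [norm_mul, Complex.norm_real, Complex.norm_I, mul_one, Real.norm_eq_abs]
  refine mul_le_of_le_one_right (by positivity) ?_
  norm_num [Nat.factorial]

/-- Comparison with a Gaussian of the same variance: a centred variable bounded by `M` satisfies
`φ(u) = exp (-Var u² / 2) + O(M |u|³ Var)`.  The error is linear in the variance, so the errors of
a sum of such variables add up to the variance of the sum. -/
lemma norm_charFun_sub_exp_le {Ω : Type*} [MeasurableSpace Ω] {μ : Measure Ω}
    [IsProbabilityMeasure μ] {W : Ω → ℝ} {M u : ℝ} (hW : AEMeasurable W μ)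
    (hM : ∀ᵐ ω ∂μ, |W ω| ≤ M) (h0 : ∫ ω, W ω ∂μ = 0) (hu : |u| * M ≤ 1) :
    ‖charFun (μ.map W) u - Complex.exp (-(Var[W; μ] * u ^ 2 / 2 : ℝ))‖
      ≤ 2 * M * |u| ^ 3 * Var[W; μ] := by
  have hM0 : 0 ≤ M := by
    obtain ⟨ω, hω⟩ := hM.exists
    exact (abs_nonneg _).trans hω
  set s := Var[W; μ] with hs
  have hs0 : 0 ≤ s := variance_nonneg _ _
  have hvar : ∫ ω, W ω ^ 2 ∂μ = s := by
    rw [hs, variance_eq_integral hW]; simp [h0]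
  have hint : Integrable W μ :=
    Integrable.of_bound hW.aestronglyMeasurable M (by simpa using hM)
  have hint2 : Integrable (fun ω => W ω ^ 2) μ :=
    Integrable.of_bound (hW.pow_const 2).aestronglyMeasurable (M ^ 2) (by
      filter_upwards [hM] with ω hω
      rw [Real.norm_eq_abs, abs_pow]; gcongr)
  have hsM : s ≤ M ^ 2 := by
    rw [← hvar]
    calc ∫ ω, W ω ^ 2 ∂μ ≤ ∫ _, M ^ 2 ∂μ := by
          refine integral_mono_ae hint2 (integrable_const _) ?_
          filter_upwards [hM] with ω hω
          exact sq_le_sq.2 (hω.trans (le_abs_self M))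
      _ = M ^ 2 := by simp
  have hexp : Integrable (fun ω => Complex.exp (u * W ω * Complex.I)) μ := by
    refine Integrable.of_bound (C := 1) (by fun_prop) (ae_of_all _ fun ω => ?_)
    rw [← Complex.ofReal_mul, Complex.norm_exp_ofReal_mul_I]
  have hpoly : Integrable (fun ω => (1 + u * W ω * Complex.I - (u * W ω) ^ 2 / 2 : ℂ)) μ := by
    refine ((integrable_const _).add ((hint.ofReal.const_mul _).mul_const _)).sub ?_
    have := ((hint2.ofReal (𝕜 := ℂ)).const_mul ((u : ℂ) ^ 2)).div_const 2
    refine this.congr (ae_of_all _ fun ω => ?_)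
    simp only [Complex.coe_algebraMap, RCLike.ofReal_pow]
    ring
  have hpolyint : ∫ ω, (1 + u * W ω * Complex.I - (u * W ω) ^ 2 / 2 : ℂ) ∂μ
      = 1 - (s * u ^ 2 / 2 : ℝ) := by
    have e : ∀ ω, (1 + u * W ω * Complex.I - (u * W ω) ^ 2 / 2 : ℂ)
        = 1 + (W ω : ℂ) * (u * Complex.I) - ((W ω ^ 2 : ℝ) : ℂ) * (u ^ 2 / 2) := by
      intro ω; push_cast; ring
    simp_rw [e]
    rw [integral_sub, integral_add, integral_mul_const, integral_mul_const,
      integral_complex_ofReal, integral_complex_ofReal, hvar, h0]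
    · simp; ring
    · exact integrable_const _
    · exact hint.ofReal.mul_const _
    · exact (integrable_const _).add (hint.ofReal.mul_const _)
    · exact hint2.ofReal.mul_const _
  have h1 : ‖charFun (μ.map W) u - (1 - (s * u ^ 2 / 2 : ℝ))‖ ≤ M * |u| ^ 3 * s := by
    rw [charFun_apply_real, integral_map hW (by fun_prop), ← hpolyint, ← integral_sub hexp hpoly]
    calc _ ≤ ∫ ω, M * |u| ^ 3 * W ω ^ 2 ∂μ := by
          refine norm_integral_le_of_norm_le (hint2.const_mul _) ?_
          filter_upwards [hM] with ω hω
          have hy : |u * W ω| ≤ 1 := by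
            rw [abs_mul]; exact (by gcongr : |u| * |W ω| ≤ |u| * M).trans hu
          have := norm_cexp_mul_I_sub_taylor_two_le hy
          rw [Complex.ofReal_mul] at this
          refine this.trans ?_
          rw [abs_mul, mul_pow, ← sq_abs (W ω)]
          calc |u| ^ 3 * |W ω| ^ 3 = |W ω| * (|u| ^ 3 * |W ω| ^ 2) := by ring
            _ ≤ M * (|u| ^ 3 * |W ω| ^ 2) := by gcongr
            _ = _ := by ring
      _ = _ := by rw [integral_const_mul, hvar]
  have hx0 : 0 ≤ s * u ^ 2 / 2 := by positivity
  have hx : s * u ^ 2 / 2 ≤ M * |u| * (M * |u|) / 2 := by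
    rw [← sq_abs u]
    calc s * |u| ^ 2 / 2 ≤ M ^ 2 * |u| ^ 2 / 2 := by gcongr
      _ = _ := by ring
  have hMu : M * |u| ≤ 1 := by rwa [mul_comm]
  have hMu0 : 0 ≤ M * |u| := by positivity
  have h2 : ‖(1 - (s * u ^ 2 / 2 : ℝ)) - Complex.exp (-(s * u ^ 2 / 2 : ℝ))‖
      ≤ M * |u| ^ 3 * s := by
    have h := Real.norm_exp_sub_one_sub_id_le (x := -(s * u ^ 2 / 2)) (by
      rw [norm_neg, Real.norm_of_nonneg hx0]; nlinarith)
    have e : (1 - (s * u ^ 2 / 2 : ℝ) : ℂ) - Complex.exp (-(s * u ^ 2 / 2 : ℝ))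
        = ((-(Real.exp (-(s * u ^ 2 / 2)) - 1 - -(s * u ^ 2 / 2)) : ℝ) : ℂ) := by
      push_cast; ring
    rw [e, Complex.norm_real, norm_neg]
    refine h.trans ?_
    rw [norm_neg, Real.norm_of_nonneg hx0]
    calc (s * u ^ 2 / 2) ^ 2 = (s * u ^ 2 / 2) * (s * u ^ 2 / 2) := by ring
      _ ≤ (s * u ^ 2 / 2) * (M * |u| * (M * |u|) / 2) := by gcongr
      _ ≤ (s * u ^ 2 / 2) * (M * |u| * 1 / 2) := by gcongr
      _ = M * (|u| * u ^ 2) * s / 4 := by ring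
      _ = M * |u| ^ 3 * s / 4 := by rw [← sq_abs u]; ring
      _ ≤ M * |u| ^ 3 * s := by
          have : 0 ≤ M * |u| ^ 3 * s := by positivity
          linarith
  calc _ = ‖(charFun (μ.map W) u - (1 - (s * u ^ 2 / 2 : ℝ)))
        + ((1 - (s * u ^ 2 / 2 : ℝ)) - Complex.exp (-(s * u ^ 2 / 2 : ℝ)))‖ := by
        congr 1; ring
    _ ≤ _ := norm_add_le _ _
    _ ≤ 2 * M * |u| ^ 3 * s := by linarith

/-! ### Central limit theorem for bounded triangular arrays -/

/-- Lévy's convergence theorem along a countably generated filter. -/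
lemma tendstoInDistribution_of_tendsto_charFun {κ Ω' : Type*} {Ω : κ → Type*}
    [∀ k, MeasurableSpace (Ω k)] {μ : (k : κ) → Measure (Ω k)} [∀ k, IsProbabilityMeasure (μ k)]
    [MeasurableSpace Ω'] {μ' : Measure Ω'} [IsProbabilityMeasure μ'] {l : Filter κ}
    [l.IsCountablyGenerated] {X : (k : κ) → Ω k → ℝ} {Z : Ω' → ℝ}
    (hX : ∀ k, AEMeasurable (X k) (μ k)) (hZ : AEMeasurable Z μ')
    (h : ∀ t, Tendsto (fun k => charFun ((μ k).map (X k)) t) l (𝓝 (charFun (μ'.map Z) t))) :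
    TendstoInDistribution X l Z μ μ' where
  forall_aemeasurable := hX
  aemeasurable_limit := hZ
  tendsto := by
    refine tendsto_of_seq_tendsto fun k hk => ?_
    exact ProbabilityMeasure.tendsto_of_tendsto_charFun fun t => (h t).comp hk

/-- Quantitative central limit theorem for characteristic functions: the standardized sum of
independent variables bounded by `B` has a characteristic function that differs from the Gaussian
one at `t` by `O(B |t|³ / s)`, where `s` is the standard deviation of the sum. -/
lemma norm_charFun_standardized_sum_sub_le {Ω : Type*} [MeasurableSpace Ω] {μ : Measure Ω}
    [IsProbabilityMeasure μ] {ι : Type*} [Fintype ι] {X : ι → Ω → ℝ} {B s t : ℝ}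
    (hX : ∀ i, AEMeasurable (X i) μ) (hB : ∀ i ω, |X i ω| ≤ B) (hindep : iIndepFun X μ)
    (hs : 0 < s) (hvar : ∑ i, Var[X i; μ] = s ^ 2) (ht : |s⁻¹ * t| * (2 * B) ≤ 1) :
    ‖charFun (μ.map fun ω => (∑ i, X i ω - ∑ i, ∫ ω, X i ω ∂μ) / s) t
      - Complex.exp (-(t ^ 2 / 2 : ℝ))‖ ≤ 4 * B * |t| ^ 3 * s⁻¹ := by
  set W : ι → Ω → ℝ := fun i ω => X i ω - ∫ ω, X i ω ∂μ with hWdef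
  have hint : ∀ i, Integrable (X i) μ := fun i =>
    Integrable.of_bound (hX i).aestronglyMeasurable B (ae_of_all _ fun ω => hB i ω)
  have hW : ∀ i, AEMeasurable (W i) μ := fun i => (hX i).sub_const _
  have hWvar : ∀ i, Var[W i; μ] = Var[X i; μ] := fun i =>
    variance_sub_const (hX i).aestronglyMeasurable _
  have hW0 : ∀ i, ∫ ω, W i ω ∂μ = 0 := fun i => by
    simp [hWdef, integral_sub (hint i) (integrable_const _)]
  have hWB : ∀ i, ∀ᵐ ω ∂μ, |W i ω| ≤ 2 * B := fun i => ae_of_all _ fun ω => by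
    have h1 : |∫ ω, X i ω ∂μ| ≤ B := by
      simpa using norm_integral_le_of_norm_le_const (μ := μ) (f := X i) (C := B)
        (ae_of_all _ fun ω => hB i ω)
    have h2 := abs_sub (X i ω) (∫ ω, X i ω ∂μ)
    have h3 := hB i ω
    simp only [hWdef]
    linarith
  have hWindep : iIndepFun W μ :=
    hindep.comp (fun i x => x - ∫ ω, X i ω ∂μ) fun i => by fun_prop
  have hsq : ∑ i, Var[W i; μ] = s ^ 2 := by simp_rw [hWvar]; exact hvar
  have hchar : charFun (μ.map fun ω => (∑ i, X i ω - ∑ i, ∫ ω, X i ω ∂μ) / s) t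
      = ∏ i, charFun (μ.map (W i)) (s⁻¹ * t) := by
    have e : (fun ω => (∑ i, X i ω - ∑ i, ∫ ω, X i ω ∂μ) / s)
        = fun ω => s⁻¹ * ∑ i, W i ω := by
      ext ω; simp only [hWdef, Finset.sum_sub_distrib]; ring
    rw [e, charFun_map_mul_comp (Finset.aemeasurable_fun_sum _ fun i _ => hW i),
      hWindep.charFun_map_fun_sum_eq_prod hW, Finset.prod_apply]
  have hgauss : Complex.exp (-(t ^ 2 / 2 : ℝ))
      = ∏ i, Complex.exp (-(Var[W i; μ] * (s⁻¹ * t) ^ 2 / 2 : ℝ)) := by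
    rw [← Complex.exp_sum, Finset.sum_neg_distrib, ← Complex.ofReal_sum, ← Finset.sum_div,
      ← Finset.sum_mul, hsq]
    congr 3
    field_simp
  have hprob : ∀ i, IsProbabilityMeasure (μ.map (W i)) := fun i =>
    Measure.isProbabilityMeasure_map (hW i)
  rw [hchar, hgauss]
  calc _ ≤ ∑ i, ‖charFun (μ.map (W i)) (s⁻¹ * t)
        - Complex.exp (-(Var[W i; μ] * (s⁻¹ * t) ^ 2 / 2 : ℝ))‖ := by
        refine norm_prod_sub_prod_le _ (fun i _ => norm_charFun_le_one _) fun i _ => ?_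
        rw [← Complex.ofReal_neg, ← Complex.ofReal_exp, Complex.norm_real, Real.norm_eq_abs,
          Real.abs_exp, Real.exp_le_one_iff, neg_nonpos]
        have := variance_nonneg (W i) μ
        positivity
    _ ≤ ∑ i, 2 * (2 * B) * |s⁻¹ * t| ^ 3 * Var[W i; μ] :=
        Finset.sum_le_sum fun i _ => norm_charFun_sub_exp_le (hW i) (hWB i) (hW0 i) ht
    _ = 4 * B * |t| ^ 3 * s⁻¹ := by
        rw [← Finset.mul_sum, hsq, abs_mul, abs_of_pos (inv_pos.2 hs)]
        field_simp
        ring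

/-- **Central limit theorem for bounded triangular arrays.**  If the rows consist of independent
variables bounded by a common constant and the variance of the row sums tends to infinity, then the
standardized row sums converge in distribution to the standard normal law. -/
theorem tendstoInDistribution_standardized_sum_of_bounded {κ : Type*} {Ω : κ → Type*}
    [∀ k, MeasurableSpace (Ω k)] {μ : (k : κ) → Measure (Ω k)} [∀ k, IsProbabilityMeasure (μ k)]
    {l : Filter κ} [l.IsCountablyGenerated] {ι : κ → Type*} [∀ k, Fintype (ι k)]
    {X : (k : κ) → ι k → Ω k → ℝ} {B : ℝ} (hX : ∀ k i, AEMeasurable (X k i) (μ k))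
    (hB : ∀ k i ω, |X k i ω| ≤ B) (hindep : ∀ k, iIndepFun (X k) (μ k))
    (hvar : Tendsto (fun k => ∑ i, Var[X k i; μ k]) l atTop) :
    TendstoInDistribution
      (fun k ω => (∑ i, X k i ω - ∑ i, ∫ ω, X k i ω ∂μ k) / √(∑ i, Var[X k i; μ k])) l
      (id : ℝ → ℝ) μ (gaussianReal 0 1) := by
  refine tendstoInDistribution_of_tendsto_charFun (fun k => ?_) aemeasurable_id fun t => ?_
  · exact ((Finset.aemeasurable_fun_sum _ fun i _ => hX k i).sub_const _).div_const _
  have hgauss : charFun ((gaussianReal 0 1).map id) t = Complex.exp (-(t ^ 2 / 2 : ℝ)) := by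
    simp [charFun_gaussianReal]
  rw [hgauss, tendsto_iff_norm_sub_tendsto_zero]
  have hinv : Tendsto (fun k => (√(∑ i, Var[X k i; μ k]))⁻¹) l (𝓝 0) :=
    tendsto_inv_atTop_zero.comp (Real.tendsto_sqrt_atTop.comp hvar)
  have hu : Tendsto (fun k => |(√(∑ i, Var[X k i; μ k]))⁻¹ * t| * (2 * B)) l (𝓝 0) := by
    simpa using (hinv.mul_const t).abs.mul_const (2 * B)
  have herr : Tendsto (fun k => 4 * B * |t| ^ 3 * (√(∑ i, Var[X k i; μ k]))⁻¹) l (𝓝 0) := by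
    simpa using hinv.const_mul (4 * B * |t| ^ 3)
  refine squeeze_zero' (Eventually.of_forall fun _ => norm_nonneg _) ?_ herr
  filter_upwards [hvar.eventually_gt_atTop 0, hu.eventually_le_const zero_lt_one] with k hk huk
  exact norm_charFun_standardized_sum_sub_le (hX k) (hB k) (hindep k) (Real.sqrt_pos.2 hk)
    (Real.sq_sqrt hk.le).symm huk

/-! ### Estimates from a single report -/

namespace PureLDPProtocol

variable {ε : ℝ} {D E : Type*} [MeasurableSpace E]

lemma measurable_supportIndicator (A : PureLDPProtocol ε D E) (v : D) :
    Measurable (A.supportIndicator v) :=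
  measurable_const.indicator (A.measurableSet_support v)

lemma supportIndicator_eq_zero_or_one (A : PureLDPProtocol ε D E) (v : D) (y : E) :
    A.supportIndicator v y = 0 ∨ A.supportIndicator v y = 1 :=
  Set.indicator_eq_zero_or_self _ _ _

lemma measurable_estimate (A : PureLDPProtocol ε D E) (v : D) : Measurable (A.estimate v) :=
  ((A.measurable_supportIndicator v).sub_const _).div_const _

lemma abs_estimate_le (A : PureLDPProtocol ε D E) (v : D) (y : E) :
    |A.estimate v y| ≤ (1 + |A.q|) / |A.p - A.q| := by
  rw [estimate, abs_div]
  gcongr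
  refine (abs_sub _ _).trans ?_
  gcongr
  rcases A.supportIndicator_eq_zero_or_one v y with h | h <;> simp [h]

lemma integral_supportIndicator (A : PureLDPProtocol ε D E) (v : D) (ν : Measure E) :
    ∫ y, A.supportIndicator v y ∂ν = ν.real {y | v ∈ A.support y} := by
  exact integral_indicator_one (A.measurableSet_support v)

lemma variance_supportIndicator (A : PureLDPProtocol ε D E) (v : D) (ν : Measure E)
    [IsProbabilityMeasure ν] :
    Var[A.supportIndicator v; ν]
      = ν.real {y | v ∈ A.support y} * (1 - ν.real {y | v ∈ A.support y}) := by
  have h2 : (A.supportIndicator v) ^ 2 = A.supportIndicator v := by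
    ext y
    rcases A.supportIndicator_eq_zero_or_one v y with h | h <;> simp [h]
  have hL : MemLp (A.supportIndicator v) 2 ν :=
    MemLp.of_bound (A.measurable_supportIndicator v).aestronglyMeasurable 1 (ae_of_all _ fun y => by
      rcases A.supportIndicator_eq_zero_or_one v y with h | h <;> simp [h])
  rw [variance_eq_sub hL, h2, integral_supportIndicator]
  ring

lemma integral_estimate (A : PureLDPProtocol ε D E) (v : D) (ν : Measure E)
    [IsProbabilityMeasure ν] :
    ∫ y, A.estimate v y ∂ν = (ν.real {y | v ∈ A.support y} - A.q) / (A.p - A.q) := by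
  have hint : Integrable (A.supportIndicator v) ν :=
    (integrable_const (1 : ℝ)).indicator (A.measurableSet_support v)
  simp only [estimate]
  rw [integral_div, integral_sub hint (integrable_const _), integral_supportIndicator]
  simp

lemma variance_estimate (A : PureLDPProtocol ε D E) (v : D) (ν : Measure E)
    [IsProbabilityMeasure ν] :
    Var[A.estimate v; ν]
      = ν.real {y | v ∈ A.support y} * (1 - ν.real {y | v ∈ A.support y}) / (A.p - A.q) ^ 2 := by
  have e : A.estimate v = fun y => (A.p - A.q)⁻¹ * (A.supportIndicator v y - A.q) := by
    ext y; rw [estimate]; ring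
  rw [e, variance_const_mul,
    variance_sub_const (A.measurable_supportIndicator v).aestronglyMeasurable,
    variance_supportIndicator, inv_pow, inv_mul_eq_div]

/-- Privacy carries null sets over from one input to another: an event of probability `0` for one
item has probability `0` for every item. -/
lemma real_perturb_eq_zero (A : PureLDPProtocol ε D E) {T : Set E} (hT : MeasurableSet T)
    {v₁ v₂ : D} (h : (A.perturb v₂).real T = 0) : (A.perturb v₁).real T = 0 := by
  have := A.isProbabilityMeasure_perturb
  rw [measureReal_eq_zero_iff] at h ⊢
  simpa [h] using A.ldp v₁ v₂ T hT

/-- The supporting probabilities of a holder and a non-holder differ, so by privacy neither the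
event "the report supports `v`" nor its complement is null. -/
lemma p_mem_Ioo_and_q_mem_Ioo [Nontrivial D] (A : PureLDPProtocol ε D E) :
    A.p ∈ Set.Ioo (0 : ℝ) 1 ∧ A.q ∈ Set.Ioo (0 : ℝ) 1 := by
  obtain ⟨x, v, hxv⟩ := exists_pair_ne D
  have := A.isProbabilityMeasure_perturb
  have hS := A.measurableSet_support v
  have hp := A.prob_support_self v
  have hq := A.prob_support_of_ne x v hxv
  have hpc := probReal_compl_eq_one_sub (μ := A.perturb v) hS
  have hqc := probReal_compl_eq_one_sub (μ := A.perturb x) hS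
  rw [hp] at hpc
  rw [hq] at hqc
  have hne := A.p_ne_q
  have zpq : A.p = 0 → A.q = 0 := fun h =>
    hq ▸ A.real_perturb_eq_zero hS (hp.trans h)
  have zqp : A.q = 0 → A.p = 0 := fun h =>
    hp ▸ A.real_perturb_eq_zero hS (hq.trans h)
  have opq : A.p = 1 → A.q = 1 := fun h => by
    have := A.real_perturb_eq_zero (v₁ := x) (v₂ := v) hS.compl (by rw [hpc, h, sub_self])
    linarith
  have oqp : A.q = 1 → A.p = 1 := fun h => by
    have := A.real_perturb_eq_zero (v₁ := v) (v₂ := x) hS.compl (by rw [hqc, h, sub_self])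
    linarith
  have hp0 : 0 ≤ A.p := hp ▸ measureReal_nonneg
  have hq0 : 0 ≤ A.q := hq ▸ measureReal_nonneg
  have hp1 : A.p ≤ 1 := hp ▸ measureReal_le_one
  have hq1 : A.q ≤ 1 := hq ▸ measureReal_le_one
  refine ⟨⟨hp0.lt_of_ne' fun h => hne ?_, hp1.lt_of_ne fun h => hne ?_⟩,
    ⟨hq0.lt_of_ne' fun h => hne ?_, hq1.lt_of_ne fun h => hne ?_⟩⟩
  · rw [h, zpq h]
  · rw [h, opq h]
  · rw [h, zqp h]
  · rw [h, oqp h]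

open scoped Classical in
lemma integral_estimate_perturb (A : PureLDPProtocol ε D E) (x v : D) :
    ∫ y, A.estimate v y ∂A.perturb x = if x = v then 1 else 0 := by
  have := A.isProbabilityMeasure_perturb
  rw [integral_estimate]
  split_ifs with h
  · rw [h, A.prob_support_self, div_self (sub_ne_zero.2 A.p_ne_q)]
  · simp [A.prob_support_of_ne x v h]

open scoped Classical in
lemma variance_estimate_perturb (A : PureLDPProtocol ε D E) (x v : D) :
    Var[A.estimate v; A.perturb x]
      = if x = v then A.p * (1 - A.p) / (A.p - A.q) ^ 2
        else A.q * (1 - A.q) / (A.p - A.q) ^ 2 := by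
  have := A.isProbabilityMeasure_perturb
  rw [variance_estimate]
  split_ifs with h
  · rw [h, A.prob_support_self]
  · rw [A.prob_support_of_ne x v h]

end PureLDPProtocol

open scoped Classical in
lemma sum_ite_eq_trueFreq {D : Type*} {n : ℕ} (x : Fin n → D) (v : D) (a b : ℝ) :
    ∑ i, (if x i = v then a else b) = n * (b + trueFreq x v * (a - b)) := by
  have hcard : (({i | x i = v} : Set (Fin n)).ncard : ℝ) = ∑ i, if x i = v then (1 : ℝ) else 0 := by
    rw [Finset.sum_boole, Set.ncard_eq_toFinset_card']
    congr 2
    ext i; simp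
  have e : ∀ i, (if x i = v then a else b) = b + (if x i = v then (1 : ℝ) else 0) * (a - b) := by
    intro i; split_ifs <;> ring
  simp_rw [e]
  rw [Finset.sum_add_distrib, ← Finset.sum_mul, ← hcard, trueFreq]
  rcases Nat.eq_zero_or_pos n with rfl | hn
  · simp [Set.ncard_eq_toFinset_card']
  · have : (n : ℝ) ≠ 0 := by positivity
    simp only [Finset.sum_const, Finset.card_univ, Fintype.card_fin, nsmul_eq_mul]
    field_simp

namespace PureLDPProtocol

variable {ε : ℝ} {D E : Type*} [MeasurableSpace E]

lemma sum_integral_estimate_perturb (A : PureLDPProtocol ε D E) {n : ℕ} (x : Fin n → D) (v : D) :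
    ∑ i, ∫ y, A.estimate v y ∂A.perturb (x i) = n * muGenuine x v := by
  classical
  simp_rw [integral_estimate_perturb]
  rw [sum_ite_eq_trueFreq]
  simp [muGenuine]

lemma sum_variance_estimate_perturb (A : PureLDPProtocol ε D E) {n : ℕ} (x : Fin n → D) (v : D) :
    ∑ i, Var[A.estimate v; A.perturb (x i)] = n ^ 2 * A.varGenuine x v := by
  classical
  simp_rw [variance_estimate_perturb]
  rw [sum_ite_eq_trueFreq, varGenuine]
  have hpq := sub_ne_zero.2 A.p_ne_q
  rcases Nat.eq_zero_or_pos n with rfl | hn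
  · simp
  · have : (n : ℝ) ≠ 0 := by positivity
    field_simp
    ring

/-- The variance of a genuine estimate is bounded below uniformly in the item held, which keeps
`σ_z²` positive and makes the total variance grow at least linearly in the number of genuine users,
whatever the data and the attack are. -/
lemma exists_pos_le_variance_estimate_perturb [Nontrivial D] (A : PureLDPProtocol ε D E) (v : D) :
    ∃ c > 0, ∀ x, c ≤ Var[A.estimate v; A.perturb x] := by
  classical
  obtain ⟨⟨hp0, hp1⟩, hq0, hq1⟩ := A.p_mem_Ioo_and_q_mem_Ioo
  have hpq := sub_ne_zero.2 A.p_ne_q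
  refine ⟨min (A.p * (1 - A.p) / (A.p - A.q) ^ 2) (A.q * (1 - A.q) / (A.p - A.q) ^ 2),
    lt_min ?_ ?_, fun x => ?_⟩
  · have := sub_pos.2 hp1; positivity
  · have := sub_pos.2 hq1; positivity
  · rw [variance_estimate_perturb]
    split_ifs
    exacts [min_le_left _ _, min_le_right _ _]

/-! ### The poisoned frequency as a sum of independent estimates -/

lemma muPoisoned_eq (A : PureLDPProtocol ε D E) (P : Measure E) {n m : ℕ} (hn : 0 < n)
    (x : Fin n → D) (v : D) :
    A.muPoisoned P m x v
      = (∑ i, ∫ y, A.estimate v y ∂A.perturb (x i) + m * ∫ y, A.estimate v y ∂P) / (n + m) := by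
  have : (0 : ℝ) < n := by positivity
  rw [sum_integral_estimate_perturb, muPoisoned, muMalicious]
  field_simp

lemma varPoisoned_eq (A : PureLDPProtocol ε D E) (P : Measure E) {n m : ℕ} (hn : 0 < n)
    (x : Fin n → D) (v : D) :
    A.varPoisoned P m x v
      = (∑ i, Var[A.estimate v; A.perturb (x i)] + m * Var[A.estimate v; P]) / (n + m) ^ 2 := by
  have : (0 : ℝ) < n := by positivity
  rw [sum_variance_estimate_perturb, varPoisoned, varMalicious]
  rcases Nat.eq_zero_or_pos m with rfl | hm
  · field_simp
  · have : (0 : ℝ) < m := by positivity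
    field_simp

lemma aggFreq_eq (A : PureLDPProtocol ε D E) {ι : Type*} [Fintype ι] (v : D) (z : ι → E) :
    A.aggFreq v z = (∑ i, A.estimate v (z i)) / Fintype.card ι := by
  simp [aggFreq, estimatedCount, supportCount, estimate, ← Finset.sum_div, Finset.sum_sub_distrib]

lemma poisonedFreq_eq (A : PureLDPProtocol ε D E) {n m : ℕ} {Ω : Type*} (v : D)
    (X : Fin n → Ω → E) (Y : Fin m → Ω → E) (ω : Ω) :
    A.poisonedFreq v X Y ω = (∑ i, A.estimate v (Sum.elim X Y i ω)) / (n + m) := by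
  simp [poisonedFreq, aggFreq_eq]

namespace IsPoisonedCollection

variable {A : PureLDPProtocol ε D E} {P : Measure E} {n m : ℕ} {x : Fin n → D} {Ω : Type*}
  [MeasurableSpace Ω] {μ : Measure Ω} {X : Fin n → Ω → E} {Y : Fin m → Ω → E}

lemma hasLaw (h : A.IsPoisonedCollection P x μ X Y) (i : Fin n ⊕ Fin m) :
    HasLaw (Sum.elim X Y i) (Sum.elim (fun i => A.perturb (x i)) (fun _ => P) i) μ := by
  rcases i with i | j
  exacts [h.hasLaw_genuine i, h.hasLaw_malicious j]

lemma integral_estimate (h : A.IsPoisonedCollection P x μ X Y) (v : D) :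
    ∑ i, ∫ ω, A.estimate v (Sum.elim X Y i ω) ∂μ
      = ∑ i, ∫ y, A.estimate v y ∂A.perturb (x i) + m * ∫ y, A.estimate v y ∂P := by
  have e (i) := (h.hasLaw i).integral_comp (A.measurable_estimate v).aestronglyMeasurable
  simp only [Function.comp_def] at e
  simp [e]

lemma variance_estimate (h : A.IsPoisonedCollection P x μ X Y) (v : D) :
    ∑ i, Var[fun ω => A.estimate v (Sum.elim X Y i ω); μ]
      = ∑ i, Var[A.estimate v; A.perturb (x i)] + m * Var[A.estimate v; P] := by
  have e (i) : Var[fun ω => A.estimate v (Sum.elim X Y i ω); μ]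
      = Var[A.estimate v; Sum.elim (fun i => A.perturb (x i)) (fun _ => P) i] := by
    rw [← (h.hasLaw i).map_eq, variance_map (A.measurable_estimate v).aemeasurable
      (h.hasLaw i).aemeasurable]
    rfl
  simp [e]

/-- The standardized poisoned frequency is the standardized sum of the single-report estimates: the
factor `n + m` by which the two differ cancels. -/
lemma poisonedFreq_sub_div_sqrt (h : A.IsPoisonedCollection P x μ X Y) (hn : 0 < n) (v : D)
    (ω : Ω) :
    (A.poisonedFreq v X Y ω - A.muPoisoned P m x v) / √(A.varPoisoned P m x v)
      = (∑ i, A.estimate v (Sum.elim X Y i ω) - ∑ i, ∫ ω, A.estimate v (Sum.elim X Y i ω) ∂μ)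
        / √(∑ i, Var[fun ω => A.estimate v (Sum.elim X Y i ω); μ]) := by
  have hnm : (0 : ℝ) < n + m := by positivity
  rw [poisonedFreq_eq, A.muPoisoned_eq P hn, A.varPoisoned_eq P hn, h.integral_estimate,
    h.variance_estimate, Real.sqrt_div' _ (by positivity), Real.sqrt_sq hnm.le, ← sub_div,
    div_div_div_cancel_right₀ hnm.ne']

end IsPoisonedCollection

end PureLDPProtocol

/-! ### Asymptotic normality of the poisoned frequency -/

theorem theorem1 {ε : ℝ} {D E : Type*} [Nontrivial D] [MeasurableSpace E]
    (A : PureLDPProtocol ε D E) (P : Measure E) [IsProbabilityMeasure P]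
    (x : (n : ℕ) → Fin n → D) (v : D)
    {Ω : ℕ → ℕ → Type*} [∀ n m, MeasurableSpace (Ω n m)]
    (μ : (n m : ℕ) → Measure (Ω n m)) [∀ n m, IsProbabilityMeasure (μ n m)]
    (X : (n m : ℕ) → Fin n → Ω n m → E) (Y : (n m : ℕ) → Fin m → Ω n m → E)
    (h : ∀ n m, A.IsPoisonedCollection P (x n) (μ n m) (X n m) (Y n m)) :
    (∀ n m : ℕ, 0 < n → 0 < m → 0 < A.varPoisoned P m (x n) v) ∧
    TendstoInDistribution
      (fun (k : ℕ × ℕ) (ω : Ω k.1 k.2) =>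
        (A.poisonedFreq v (X k.1 k.2) (Y k.1 k.2) ω - A.muPoisoned P k.2 (x k.1) v)
          / √(A.varPoisoned P k.2 (x k.1) v))
      (atTop ×ˢ atTop) (id : ℝ → ℝ) (fun k => μ k.1 k.2) (gaussianReal 0 1) := by
  obtain ⟨c, hc, hcle⟩ := A.exists_pos_le_variance_estimate_perturb v
  have hlow (n m : ℕ) : n * c
      ≤ ∑ i, Var[A.estimate v; A.perturb (x n i)] + m * Var[A.estimate v; P] := by
    have h1 : n * c ≤ ∑ i, Var[A.estimate v; A.perturb (x n i)] := by
      simpa using Finset.card_nsmul_le_sum Finset.univ _ c fun i _ => hcle (x n i)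
    have h2 := variance_nonneg (A.estimate v) P
    have h3 : 0 ≤ m * Var[A.estimate v; P] := by positivity
    linarith
  refine ⟨fun n m hn _ => ?_, ?_⟩
  · have hnm : (0 : ℝ) < n + m := by positivity
    rw [A.varPoisoned_eq P hn]
    exact div_pos (lt_of_lt_of_le (by positivity) (hlow n m)) (by positivity)
  have hmeas (k : ℕ × ℕ) (i) : AEMeasurable
      (fun ω => A.estimate v (Sum.elim (X k.1 k.2) (Y k.1 k.2) i ω)) (μ k.1 k.2) :=
    (A.measurable_estimate v).comp_aemeasurable ((h k.1 k.2).hasLaw i).aemeasurable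
  have hvar : Tendsto (fun k : ℕ × ℕ => ∑ i,
      Var[fun ω => A.estimate v (Sum.elim (X k.1 k.2) (Y k.1 k.2) i ω); μ k.1 k.2])
      (atTop ×ˢ atTop) atTop := by
    refine tendsto_atTop_mono (f := fun k : ℕ × ℕ => (k.1 : ℝ) * c) (fun k => ?_) ?_
    · rw [(h k.1 k.2).variance_estimate]
      exact hlow k.1 k.2
    · exact (tendsto_natCast_atTop_atTop.comp tendsto_fst).atTop_mul_const hc
  have hclt := tendstoInDistribution_standardized_sum_of_bounded (μ := fun k : ℕ × ℕ => μ k.1 k.2)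
    hmeas (fun k i ω => A.abs_estimate_le v _)
    (fun k => (h k.1 k.2).indep.comp (fun _ => A.estimate v) fun _ => A.measurable_estimate v) hvar
  refine ⟨fun k => ?_, aemeasurable_id, hclt.tendsto.congr' ?_⟩
  · simp_rw [PureLDPProtocol.poisonedFreq_eq]
    exact (((Finset.aemeasurable_fun_sum _ fun i _ => hmeas k i).div_const _).sub_const _).div_const
      _
  -- For `n = 0` the ratio `m / n` is a junk value; these indices do not affect the limit.
  · filter_upwards [tendsto_fst.eventually (eventually_gt_atTop 0)] with k hk
    exact Subtype.ext (congrArg (Measure.map · _)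
      (funext fun ω => ((h k.1 k.2).poisonedFreq_sub_div_sqrt hk v ω).symm))
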